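/- Let $\ell\ge 2$ and $D\ge 1$ be integers. For $n\ge 0$ let $\mathcal F_n$ be the family of $\ell$-adic cubes $\prod_{i=1}^D[k_i\ell^{-n},(k_i+1)\ell^{-n})$, $0\le k_i<\ell^n$, of $[0,1)^D$. Suppose that the cubes are coded by the finite words over $\{0,\dots,\ell^D-1\}$: for every $n$ the map $\varepsilon_1\cdots\varepsilon_n\mapsto I_{\varepsilon_1\cdots\varepsilon_n}$ is a bijection from the words of length $n$ onto $\mathcal F_n$, and $I_{\varepsilon_1\cdots\varepsilon_{n+1}}\subset I_{\varepsilon_1\cdots\varepsilon_n}$. For $I=I_{\varepsilon_1\cdots\varepsilon_n}$ and $J=I_{\varepsilon_{n+1}\cdots\varepsilon_{n+p}}$ put $IJ=I_{\varepsilon_1\cdots\varepsilon_{n+p}}$. Let $m$ be a quasi-Bernoulli measure on $[0,1)^D$, i.e. a Borel probability measure on $\mathbb R^D$ with $m([0,1)^D)=1$ for which there is a constant $C\ge 1$ such that $$\frac1C\,m(I)m(J)\le m(IJ)\le C\,m(I)m(J)\qquad\text{for all } I,J\in\bigcup_{n\ge 0}\mathcal F_n .$$ Let $$\tau(q)=\limsup_{n\to\infty}\frac1{n\log\ell}\log\Big(\sum_{I\in\mathcal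 F_n,\ m(I)>0}m(I)^q\Big)\qquad(q\in\mathbb R)$$ be its $L^q$-spectrum and $d=-\tau'(1)$. Suppose that there is a real $\sigma>0$ such that $$\tau(1-q)=qd+\frac{\sigma^2}{2}q^2+o(q^2)\qquad\text{as } q\to 0 .$$ Let $\mathcal H^d$ be the $d$-dimensional Hausdorff measure on $\mathbb R^D$ and let $\widehat{\mathcal P}^d$ be the $d$-dimensional packing (outer) measure $$\widehat{\mathcal P}^d(E)=\inf\Big\{\sum_{j\ge 1}\mathcal P^d(E_j):\ E\subset\bigcup_{j\ge 1} E_j\Big\},\qquad \mathcal P^d(E)=\lim_{\delta\to 0^+}\ \sup\sum_i(2r_i)^d ,$$ where the supremum is over all families of pairwise disjoint closed balls $B(x_i,r_i)$ with $x_i\in E$ and $0<r_i\le\delta$. Then: 1. There exists a Borel set $E\subset\mathbb R^D$ such that $m(E)=1$ and $\mathcal H^d(E)=0$. In particular $m\perp\mathcal H^d$. 2. For every set $E\subset\mathbb R^D$, if $\widehat{\mathcal P}^d(E)<+\infty$ then $m(E)=0$ (where $m(E)$ is the outer measure if $E$ is not measurable). In particular $m\ll\widehat{\mathcal P}^d$,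 i.e. $\widehat{\mathcal P}^d(E)=0$ implies $m(E)=0$. -/

import Mathlib

open MeasureTheory Filter Topology Asymptotics
open scoped ENNReal

noncomputable section

namespace QB

/-- The half-open cube `∏ i, [k i / ℓ ^ n, (k i + 1) / ℓ ^ n)` of `ℝ ^ D`. -/
def ladicCube (ℓ D n : ℕ) (k : Fin D → Fin (ℓ ^ n)) : Set (EuclideanSpace ℝ (Fin D)) :=
  {x | ∀ i, ((k i : ℕ) : ℝ) / (ℓ : ℝ) ^ n ≤ x i ∧ x i < (((k i : ℕ) : ℝ) + 1) / (ℓ : ℝ) ^ n}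

/-- The family `F_n` of the `ℓ`-adic cubes of generation `n` in `[0, 1) ^ D`. -/
def ladicCubes (ℓ D n : ℕ) : Set (Set (EuclideanSpace ℝ (Fin D))) :=
  Set.range (ladicCube ℓ D n)

/-- The unit cube `[0, 1) ^ D`. -/
def unitCube (D : ℕ) : Set (EuclideanSpace ℝ (Fin D)) :=
  {x | ∀ i, 0 ≤ x i ∧ x i < 1}

/-- `I` codes the `ℓ`-adic cubes by the finite words over the alphabet `{0, …, ℓ ^ D - 1}`:
the words of length `n` correspond one-to-one to the cubes of generation `n`, and the cube of a
word contains the cubes of its one-letter extensions. -/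
structure IsCubeCoding (ℓ D : ℕ)
    (I : List (Fin (ℓ ^ D)) → Set (EuclideanSpace ℝ (Fin D))) : Prop where
  bijOn : ∀ n : ℕ, Set.BijOn I {w | w.length = n} (ladicCubes ℓ D n)
  nested : ∀ (w : List (Fin (ℓ ^ D))) (a : Fin (ℓ ^ D)), I (w ++ [a]) ⊆ I w

/-- `m` is carried by `[0, 1) ^ D` and is quasi-Bernoulli for the coding `I`; the product of the
cubes `I u` and `I v` is the cube `I (u ++ v)` of the concatenated word. -/
structure IsQuasiBernoulli {ℓ D : ℕ} (I : List (Fin (ℓ ^ D)) → Set (EuclideanSpace ℝ (Fin D)))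
    (m : Measure (EuclideanSpace ℝ (Fin D))) : Prop where
  unitCube_eq_one : m (unitCube D) = 1
  quasiBernoulli : ∃ C : ℝ, 1 ≤ C ∧ ∀ u v : List (Fin (ℓ ^ D)),
    1 / C * (m.real (I u) * m.real (I v)) ≤ m.real (I (u ++ v)) ∧
      m.real (I (u ++ v)) ≤ C * (m.real (I u) * m.real (I v))

open Classical in
/-- `τ_n(q) = (n log ℓ)⁻¹ log (∑ m(I) ^ q)`, where `I` runs over the cubes of generation `n`
that have positive measure (so that `0 ^ q = 0` for every real `q`). -/
def lqSpectrumAt (ℓ : ℕ) {D : ℕ} (m : Measure (EuclideanSpace ℝ (Fin D))) (n : ℕ) (q : ℝ) : ℝ :=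
  1 / (n * Real.log ℓ) *
    Real.log (∑ k : Fin D → Fin (ℓ ^ n),
      if 0 < m.real (ladicCube ℓ D n k) then m.real (ladicCube ℓ D n k) ^ q else 0)

/-- The `L^q`-spectrum `τ(q) = limsup τ_n(q)`. -/
def lqSpectrum (ℓ : ℕ) {D : ℕ} (m : Measure (EuclideanSpace ℝ (Fin D))) (q : ℝ) : ℝ :=
  limsup (fun n : ℕ => lqSpectrumAt ℓ m n q) atTop

/-- `sup ∑ (2 r) ^ s` over the families of pairwise disjoint closed balls with centres `x` in `E`
and radii `0 < r ≤ δ`; a ball is given by the pair `(x, r)`. -/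
def packingAt {X : Type*} [PseudoMetricSpace X] (s δ : ℝ) (E : Set X) : ℝ≥0∞ :=
  ⨆ (F : Set (X × ℝ)) (_ : ∀ p ∈ F, p.1 ∈ E ∧ 0 < p.2 ∧ p.2 ≤ δ)
    (_ : F.PairwiseDisjoint fun p => Metric.closedBall p.1 p.2),
    ∑' p : F, ENNReal.ofReal (2 * p.1.2) ^ s

/-- The packing pre-measure, that is the limit (infimum) of `packingAt s δ E` as `δ` decreases
to `0`. -/
def packingPreMeasure {X : Type*} [PseudoMetricSpace X] (s : ℝ) (E : Set X) : ℝ≥0∞ :=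
  ⨅ (δ : ℝ) (_ : 0 < δ), packingAt s δ E

theorem packingPreMeasure_empty {X : Type*} [PseudoMetricSpace X] (s : ℝ) :
    packingPreMeasure s (∅ : Set X) = 0 := by
  refine le_antisymm ?_ bot_le
  refine iInf₂_le_of_le 1 one_pos ?_
  refine iSup_le fun F => iSup_le fun hF => iSup_le fun _ => ?_
  have h : IsEmpty F := ⟨fun p => (hF p.1 p.2).1⟩
  simp

/-- The `s`-dimensional packing (outer) measure, defined on all sets:
the infimum of `∑ packingPreMeasure s (E j)` over the countable covers `(E j)` of the set. -/
def packingMeasure (X : Type*) [PseudoMetricSpace X] (s : ℝ) : OuterMeasure X :=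
  OuterMeasure.ofFunction (packingPreMeasure s) (packingPreMeasure_empty s)

end QB

end

/-!
By quasi-multiplicativity the logarithm of the partition function of generation `n` differs from
`n τ(q) log ℓ` by a bounded amount, uniformly in `n`. Hence the expansion of `τ` at `1` makes the
Laplace transform of the deviation `X_n = -log m(I) - n d log ℓ`, where `I` is the cube of
generation `n` of an `m`-random point, Gaussian up to constants at the scale `√n`, and a
Paley–Zygmund argument gives `X_n > √n`, and likewise `X_n < -√n`, with probability bounded below.
Quasi-multiplicativity transfers both bounds into every cube, so the events `X_n > √n / 2` and
`X_n < -√n / 2` occur infinitely often on sets of density bounded below in every cube, hence almost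
surely. The second one says that the upper `d`-density of `m` is almost everywhere infinite, whence
the Hausdorff part. The first one says that its lower `d`-density vanishes, whence the packing part;
here a Borel–Cantelli argument shows that eventually the mass of a ball exceeds that of the cube of
its centre by at most a factor `exp (√n / 4)`. Both conclusions follow from Vitali's covering lemma.
-/

namespace QB

section QuasiAdditive

variable {u : ℕ → ℝ} {c : ℝ}

theorem abs_le_of_quasiAdditive (h : ∀ n k, |u (n + k) - u n - u k| ≤ c) (n : ℕ) :
    |u n| ≤ n * (|u 1| + c) + c := by
  induction n with
  | zero => simpa using h 0 0
  | succ n ih =>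
    have htri := abs_add_three (u (n + 1) - u n - u 1) (u n) (u 1)
    rw [show u (n + 1) - u n - u 1 + u n + u 1 = u (n + 1) by ring] at htri
    push_cast
    linarith [h n 1]

theorem exists_tendsto_div_of_quasiAdditive_le (h : ∀ n k, |u (n + k) - u n - u k| ≤ c) :
    ∃ L, Tendsto (fun n : ℕ => u n / n) atTop (𝓝 L) ∧ ∀ n : ℕ, n * L ≤ u n + c := by
  have hsub : Subadditive fun n => u n + c := fun n k => by
    linarith [(abs_le.1 (h n k)).2]
  have hbdd : BddBelow (Set.range fun n : ℕ => (u n + c) / n) := by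
    refine ⟨-(|u 1| + c), ?_⟩
    rintro _ ⟨n, rfl⟩
    have hc : 0 ≤ c := (abs_nonneg _).trans (h 0 0)
    rcases n.eq_zero_or_pos with rfl | hn
    · simp only [Nat.cast_zero, div_zero]
      linarith [abs_nonneg (u 1)]
    · rw [le_div_iff₀ (Nat.cast_pos.2 hn)]
      linarith [(abs_le.1 (abs_le_of_quasiAdditive h n)).1]
  refine ⟨hsub.lim, ?_, fun n => ?_⟩
  · simpa [add_div] using
      (hsub.tendsto_lim hbdd).sub (tendsto_const_div_atTop_nhds_zero_nat c)
  · rcases n.eq_zero_or_pos with rfl | hn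
    · simpa [neg_le_iff_add_nonneg] using (abs_le.1 (abs_le_of_quasiAdditive h 0)).1
    · rw [mul_comm, ← le_div_iff₀ (Nat.cast_pos.2 hn)]
      exact hsub.lim_le_div hbdd hn.ne'

theorem exists_tendsto_div_of_quasiAdditive (h : ∀ n k, |u (n + k) - u n - u k| ≤ c) :
    ∃ L, Tendsto (fun n : ℕ => u n / n) atTop (𝓝 L) ∧ ∀ n : ℕ, |u n - n * L| ≤ c := by
  obtain ⟨L, hL, hle⟩ := exists_tendsto_div_of_quasiAdditive_le h
  obtain ⟨L', hL', hle'⟩ := exists_tendsto_div_of_quasiAdditive_le (u := -u) (c := c) fun n k => by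
    rw [← abs_neg]
    convert h n k using 2
    simp only [Pi.neg_apply]
    ring
  have hneg : L' = -L := by
    refine tendsto_nhds_unique hL' ?_
    simpa [neg_div] using hL.neg
  refine ⟨L, hL, fun n => abs_le.2 ⟨?_, ?_⟩⟩
  · linarith [hle n]
  · have := hle' n
    rw [hneg, Pi.neg_apply] at this
    linarith

end QuasiAdditive

section FiniteSums

variable {ι : Type*} {s : Finset ι}

theorem log_sum_le_add_log_sum {f g : ι → ℝ} {c : ℝ} (hs : s.Nonempty) (hf : ∀ i ∈ s, 0 < f i)
    (hg : ∀ i ∈ s, 0 < g i) (h : ∀ i ∈ s, Real.log (f i) ≤ c + Real.log (g i)) :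
    Real.log (∑ i ∈ s, f i) ≤ c + Real.log (∑ i ∈ s, g i) := by
  rw [Real.log_le_iff_le_exp (Finset.sum_pos hf hs), Real.exp_add,
    Real.exp_log (Finset.sum_pos hg hs), Finset.mul_sum]
  refine Finset.sum_le_sum fun i hi => ?_
  rw [← Real.exp_log (hg i hi), ← Real.exp_add, ← Real.log_le_iff_le_exp (hf i hi)]
  exact h i hi

theorem abs_log_sum_sub_log_sum_le {f g : ι → ℝ} {c : ℝ} (hs : s.Nonempty)
    (hf : ∀ i ∈ s, 0 < f i) (hg : ∀ i ∈ s, 0 < g i)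
    (h : ∀ i ∈ s, |Real.log (f i) - Real.log (g i)| ≤ c) :
    |Real.log (∑ i ∈ s, f i) - Real.log (∑ i ∈ s, g i)| ≤ c := by
  rw [abs_sub_le_iff]
  refine ⟨sub_le_iff_le_add.2 (log_sum_le_add_log_sum hs hf hg fun i hi => ?_),
    sub_le_iff_le_add.2 (log_sum_le_add_log_sum hs hg hf fun i hi => ?_)⟩
  · exact sub_le_iff_le_add.1 (abs_sub_le_iff.1 (h i hi)).1
  · exact sub_le_iff_le_add.1 (abs_sub_le_iff.1 (h i hi)).2

variable {p Y : ι → ℝ}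

theorem exp_le_sum_filter_mul_exp (hp : ∀ i ∈ s, 0 ≤ p i) (hp1 : ∑ i ∈ s, p i ≤ 1) {θ b : ℝ}
    (hθ : 0 ≤ θ) (hM : 2 * Real.exp (θ * b) ≤ ∑ i ∈ s, p i * Real.exp (θ * Y i)) :
    Real.exp (θ * b) ≤ ∑ i ∈ s with b < Y i, p i * Real.exp (θ * Y i) := by
  have hlow : ∑ i ∈ s with ¬ b < Y i, p i * Real.exp (θ * Y i) ≤ Real.exp (θ * b) :=
    calc ∑ i ∈ s with ¬ b < Y i, p i * Real.exp (θ * Y i)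
        ≤ ∑ i ∈ s with ¬ b < Y i, p i * Real.exp (θ * b) := by
          refine Finset.sum_le_sum fun i hi => ?_
          obtain ⟨his, hib⟩ := Finset.mem_filter.1 hi
          have := hp i his
          have := not_lt.1 hib
          gcongr
      _ ≤ ∑ i ∈ s, p i * Real.exp (θ * b) :=
          Finset.sum_le_sum_of_subset_of_nonneg (Finset.filter_subset _ _)
            fun i hi _ => mul_nonneg (hp i hi) (Real.exp_nonneg _)
      _ = (∑ i ∈ s, p i) * Real.exp (θ * b) := (Finset.sum_mul ..).symm
      _ ≤ Real.exp (θ * b) := mul_le_of_le_one_left (Real.exp_nonneg _) hp1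
  have hsplit := Finset.sum_filter_add_sum_filter_not s (fun i => b < Y i)
    fun i => p i * Real.exp (θ * Y i)
  linarith

/-- The Paley–Zygmund argument: if the exponential moment is not explained by the values
`Y i ≤ b`, then Cauchy–Schwarz on `{b < Y}` bounds the tail from below. -/
theorem exp_sq_le_tail_mul_sum_exp (hp : ∀ i ∈ s, 0 ≤ p i) (hp1 : ∑ i ∈ s, p i ≤ 1) {θ b : ℝ}
    (hθ : 0 ≤ θ) (hM : 2 * Real.exp (θ * b) ≤ ∑ i ∈ s, p i * Real.exp (θ * Y i)) :
    Real.exp (θ * b) ^ 2 ≤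
      (∑ i ∈ s with b < Y i, p i) * ∑ i ∈ s, p i * Real.exp (2 * θ * Y i) := by
  have hp' : ∀ i ∈ s.filter (b < Y ·), 0 ≤ p i := fun i hi => hp i (Finset.mem_filter.1 hi).1
  calc Real.exp (θ * b) ^ 2
      ≤ (∑ i ∈ s with b < Y i, p i * Real.exp (θ * Y i)) ^ 2 := by
        gcongr
        exact exp_le_sum_filter_mul_exp hp hp1 hθ hM
    _ ≤ (∑ i ∈ s with b < Y i, p i) *
          ∑ i ∈ s with b < Y i, p i * Real.exp (2 * θ * Y i) := by
        refine Finset.sum_sq_le_sum_mul_sum_of_sq_le_mul _ hp'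
          (fun i hi => mul_nonneg (hp' i hi) (Real.exp_nonneg _)) fun i _ => le_of_eq ?_
        rw [mul_assoc, two_mul, Real.exp_add]
        ring
    _ ≤ _ := mul_le_mul_of_nonneg_left
        (Finset.sum_le_sum_of_subset_of_nonneg (Finset.filter_subset _ _)
          fun i hi _ => mul_nonneg (hp i hi) (Real.exp_nonneg _)) (Finset.sum_nonneg hp')

theorem exists_pos_add_le_mul_sq {a : ℝ} (ha : 0 < a) (c : ℝ) : ∃ t, 0 < t ∧ c + t ≤ a * t ^ 2 := by
  have hlim : Tendsto (fun t : ℝ => t * (a * t - 1)) atTop atTop :=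
    tendsto_id.atTop_mul_atTop₀
      (tendsto_atTop_add_const_right _ _ (tendsto_id.const_mul_atTop ha))
  obtain ⟨t, hct, ht⟩ := ((hlim.eventually_ge_atTop c).and (eventually_gt_atTop 0)).exists
  exact ⟨t, ht, by linarith⟩

theorem exists_pos_eventually_le_tail {α : Type*} {l : Filter α} {s : α → Finset ι} {r : α → ℝ}
    {a b K : ℝ} (hp : ∀ i, 0 ≤ p i) (hp1 : ∀ n, ∑ i ∈ s n, p i ≤ 1) (hr : ∀ᶠ n in l, 0 < r n)
    (ha : 0 < a) (hM : ∀ t, 0 < t → ∀ᶠ n in l, ∑ i ∈ s n, p i * Real.exp (t / r n * Y i) ∈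
      Set.Icc (Real.exp (a * t ^ 2 - K)) (Real.exp (b * t ^ 2 + K))) :
    ∃ c, 0 < c ∧ ∀ᶠ n in l, c ≤ ∑ i ∈ s n with r n < Y i, p i := by
  obtain ⟨t, ht, hat⟩ := exists_pos_add_le_mul_sq ha (Real.log 2 + K)
  refine ⟨Real.exp t ^ 2 / Real.exp (b * (2 * t) ^ 2 + K), by positivity, ?_⟩
  filter_upwards [hM t ht, hM (2 * t) (by positivity), hr] with n hMt hM2t hrn
  have hlarge : 2 * Real.exp (t / r n * r n) ≤ ∑ i ∈ s n, p i * Real.exp (t / r n * Y i) := by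
    refine le_trans ?_ hMt.1
    rw [div_mul_cancel₀ _ hrn.ne', ← Real.exp_log two_pos, ← Real.exp_add, Real.exp_le_exp]
    linarith
  have hPZ := exp_sq_le_tail_mul_sum_exp (fun i _ => hp i) (hp1 n) (by positivity) hlarge
  rw [div_mul_cancel₀ _ hrn.ne', ← mul_div_assoc] at hPZ
  rw [div_le_iff₀ (Real.exp_pos _)]
  exact hPZ.trans (mul_le_mul_of_nonneg_left hM2t.2 (Finset.sum_nonneg fun i _ => hp i))

end FiniteSums

theorem tendsto_sqrt_natCast_atTop : Tendsto (fun n : ℕ => √(n : ℝ)) atTop atTop :=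
  Real.tendsto_sqrt_atTop.comp tendsto_natCast_atTop_atTop

theorem tendsto_natCast_mul_comp_div_sqrt {F : ℝ → ℝ} {a : ℝ}
    (hF : (fun q : ℝ => F q - a * q ^ 2) =o[𝓝 0] fun q : ℝ => q ^ 2) (t : ℝ) :
    Tendsto (fun n : ℕ => n * F (t / √n)) atTop (𝓝 (a * t ^ 2)) := by
  have hscale : Tendsto (fun n : ℕ => t / √n) atTop (𝓝 0) :=
    tendsto_const_nhds.div_atTop tendsto_sqrt_natCast_atTop
  have hsq : ∀ᶠ n : ℕ in atTop, n * (t / √n) ^ 2 = t ^ 2 := by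
    filter_upwards [eventually_gt_atTop 0] with n hn
    have hn' : (0 : ℝ) < n := Nat.cast_pos.2 hn
    rw [div_pow, Real.sq_sqrt hn'.le, mul_div_cancel₀ _ hn'.ne']
  have herr : (fun n : ℕ => n * F (t / √n) - a * t ^ 2) =o[atTop] fun _ => t ^ 2 := by
    refine ((isBigO_refl (fun n : ℕ => (n : ℝ)) atTop).mul_isLittleO
      (hF.comp_tendsto hscale)).congr' ?_ hsq
    filter_upwards [hsq] with n hn
    rw [← hn, Function.comp_apply]
    ring
  exact tendsto_sub_nhds_zero_iff.1
    ((isLittleO_one_iff ℝ).1 (herr.trans_isBigO (isBigO_const_one ℝ _ _)))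

section Words

variable {A : Type*}

/-- The logarithmic weight `-log p(w)`, centred at its typical value `|w| h`. Its fluctuations of
order `√|w|` decide how the weights compare with powers of the diameters. -/
noncomputable def deviation (p : List A → ℝ) (h : ℝ) (w : List A) : ℝ :=
  -Real.log (p w) - w.length * h

theorem exp_neg_deviation_mul_inv_pow_rpow {p : List A → ℝ} {w : List A} (hw : 0 < p w)
    {ℓ : ℕ} (hℓ : 0 < ℓ) (d : ℝ) :
    Real.exp (-deviation p (d * Real.log ℓ) w) * ((ℓ : ℝ) ^ w.length)⁻¹ ^ d = p w := by
  rw [deviation, Real.rpow_def_of_pos (by positivity), Real.log_inv, Real.log_pow, ← Real.exp_add]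
  nth_rw 2 [← Real.exp_log hw]
  ring_nf

variable [Finite A]

/-- The words of length `n` over a finite alphabet. -/
noncomputable def words (A : Type*) [Finite A] (n : ℕ) : Finset (List A) :=
  (List.finite_length_eq A n).toFinset

theorem mem_words {n : ℕ} {w : List A} : w ∈ words A n ↔ w.length = n := by
  simp [words]

/-- A family of weights on the finite words, of total mass `1` in each length, that is
multiplicative up to the constant `C`: the masses of the cylinders of a quasi-Bernoulli measure. -/
structure IsQuasiMultiplicative (p : List A → ℝ) (C : ℝ) : Prop where
  one_le : 1 ≤ C
  nonneg : ∀ w, 0 ≤ p w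
  sum_eq_one : ∀ n, ∑ w ∈ words A n, p w = 1
  le_append : ∀ u v, 1 / C * (p u * p v) ≤ p (u ++ v)
  append_le : ∀ u v, p (u ++ v) ≤ C * (p u * p v)

/-- The words of length `n` with positive weight. -/
noncomputable def posWords (p : List A → ℝ) (n : ℕ) : Finset (List A) :=
  {w ∈ words A n | 0 < p w}

/-- The partition function `∑ p(w) ^ q` over the words of length `n`; the words of weight `0` are
left out, so that they do not contribute for `q ≤ 0`. -/
noncomputable def partitionSum (p : List A → ℝ) (n : ℕ) (q : ℝ) : ℝ :=
  ∑ w ∈ posWords p n, p w ^ q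

theorem mem_posWords {p : List A → ℝ} {n : ℕ} {w : List A} :
    w ∈ posWords p n ↔ w.length = n ∧ 0 < p w := by
  rw [posWords, Finset.mem_filter, mem_words]

theorem sum_mul_exp_deviation (p : List A → ℝ) (h : ℝ) (n : ℕ) (θ : ℝ) :
    ∑ w ∈ posWords p n, p w * Real.exp (θ * deviation p h w) =
      partitionSum p n (1 - θ) * Real.exp (-(n * (θ * h))) := by
  rw [partitionSum, Finset.sum_mul]
  refine Finset.sum_congr rfl fun w hw => ?_
  obtain ⟨rfl, hpos⟩ := mem_posWords.1 hw
  nth_rw 1 [← Real.exp_log hpos]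
  rw [Real.rpow_def_of_pos hpos, ← Real.exp_add, ← Real.exp_add, deviation]
  ring_nf

namespace IsQuasiMultiplicative

variable {p : List A → ℝ} {C : ℝ}

theorem append_pos_iff (hp : IsQuasiMultiplicative p C) {u v : List A} :
    0 < p (u ++ v) ↔ 0 < p u ∧ 0 < p v := by
  have hC : 0 < C := zero_lt_one.trans_le hp.one_le
  constructor
  · intro huv
    have hmul : 0 < p u * p v := pos_of_mul_pos_right (huv.trans_le (hp.append_le u v)) hC.le
    exact ⟨pos_of_mul_pos_left hmul (hp.nonneg v), pos_of_mul_pos_right hmul (hp.nonneg u)⟩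
  · rintro ⟨hu, hv⟩
    exact lt_of_lt_of_le (by positivity) (hp.le_append u v)

theorem abs_log_append_sub_le (hp : IsQuasiMultiplicative p C) {u v : List A} (hu : 0 < p u)
    (hv : 0 < p v) :
    |Real.log (p (u ++ v)) - (Real.log (p u) + Real.log (p v))| ≤ Real.log C := by
  have hC : 0 < C := zero_lt_one.trans_le hp.one_le
  have hlow := Real.log_le_log (by positivity) (hp.le_append u v)
  have hup := Real.log_le_log (hp.append_pos_iff.2 ⟨hu, hv⟩) (hp.append_le u v)
  rw [one_div, Real.log_mul (by positivity) (by positivity), Real.log_mul hu.ne' hv.ne',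
    Real.log_inv] at hlow
  rw [Real.log_mul hC.ne' (by positivity), Real.log_mul hu.ne' hv.ne'] at hup
  rw [abs_sub_le_iff]
  constructor <;> linarith

theorem abs_deviation_append_sub_le (hp : IsQuasiMultiplicative p C) (h : ℝ) {u v : List A}
    (hu : 0 < p u) (hv : 0 < p v) :
    |deviation p h (u ++ v) - (deviation p h u + deviation p h v)| ≤ Real.log C := by
  rw [← abs_neg]
  convert hp.abs_log_append_sub_le hu hv using 2
  simp only [deviation, List.length_append, Nat.cast_add]
  ring

theorem sum_posWords (hp : IsQuasiMultiplicative p C) (n : ℕ) : ∑ w ∈ posWords p n, p w = 1 := by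
  rw [← hp.sum_eq_one n, posWords, Finset.sum_filter_of_ne]
  exact fun w _ hw => (hp.nonneg w).lt_of_ne' hw

theorem posWords_nonempty (hp : IsQuasiMultiplicative p C) (n : ℕ) : (posWords p n).Nonempty :=
  Finset.nonempty_of_sum_ne_zero ((hp.sum_posWords n).trans_ne one_ne_zero)

theorem partitionSum_pos (hp : IsQuasiMultiplicative p C) (n : ℕ) (q : ℝ) :
    0 < partitionSum p n q :=
  Finset.sum_pos (fun _ hw => Real.rpow_pos_of_pos (mem_posWords.1 hw).2 _)
    (hp.posWords_nonempty n)

theorem sum_posWords_add (hp : IsQuasiMultiplicative p C) (n k : ℕ) (f : List A → ℝ) :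
    ∑ w ∈ posWords p (n + k), f w = ∑ x ∈ posWords p n ×ˢ posWords p k, f (x.1 ++ x.2) := by
  symm
  refine Finset.sum_nbij' (fun x => x.1 ++ x.2) (fun w : List A => (w.take n, w.drop n))
    ?_ ?_ ?_ ?_ fun _ _ => rfl
  · simp only [Finset.mem_product, mem_posWords, List.length_append]
    rintro x ⟨⟨hn, hu⟩, hk, hv⟩
    exact ⟨by rw [hn, hk], hp.append_pos_iff.2 ⟨hu, hv⟩⟩
  · simp only [Finset.mem_product, mem_posWords, List.length_take, List.length_drop]
    rintro w ⟨hlen, hw⟩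
    rw [← List.take_append_drop n w, hp.append_pos_iff] at hw
    exact ⟨⟨by lia, hw.1⟩, by lia, hw.2⟩
  · simp only [Finset.mem_product, mem_posWords]
    rintro ⟨u, v⟩ ⟨⟨rfl, -⟩, -⟩
    rw [List.take_left, List.drop_left]
  · exact fun w _ => List.take_append_drop n w

theorem abs_log_partitionSum_add_le (hp : IsQuasiMultiplicative p C) (q : ℝ) (n k : ℕ) :
    |Real.log (partitionSum p (n + k) q) - Real.log (partitionSum p n q) -
      Real.log (partitionSum p k q)| ≤ |q| * Real.log C := by
  rw [sub_sub, ← Real.log_mul (hp.partitionSum_pos n q).ne' (hp.partitionSum_pos k q).ne',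
    partitionSum, partitionSum, partitionSum, hp.sum_posWords_add, Finset.sum_mul_sum,
    ← Finset.sum_product']
  have hpos : ∀ x ∈ posWords p n ×ˢ posWords p k, 0 < p x.1 ∧ 0 < p x.2 := fun x hx =>
    ⟨(mem_posWords.1 (Finset.mem_product.1 hx).1).2, (mem_posWords.1 (Finset.mem_product.1 hx).2).2⟩
  refine abs_log_sum_sub_log_sum_le ((hp.posWords_nonempty n).product (hp.posWords_nonempty k))
    (fun x hx => Real.rpow_pos_of_pos (hp.append_pos_iff.2 (hpos x hx)) q)
    (fun x hx => mul_pos (Real.rpow_pos_of_pos (hpos x hx).1 q)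
      (Real.rpow_pos_of_pos (hpos x hx).2 q)) fun x hx => ?_
  obtain ⟨hu, hv⟩ := hpos x hx
  rw [Real.log_mul (Real.rpow_pos_of_pos hu q).ne' (Real.rpow_pos_of_pos hv q).ne',
    Real.log_rpow hu, Real.log_rpow hv, Real.log_rpow (hp.append_pos_iff.2 ⟨hu, hv⟩),
    ← mul_add, ← mul_sub, abs_mul]
  gcongr
  exact hp.abs_log_append_sub_le hu hv

theorem abs_log_partitionSum_sub_le (hp : IsQuasiMultiplicative p C) {q L : ℝ}
    (hL : Tendsto (fun n : ℕ => Real.log (partitionSum p n q) / n) atTop (𝓝 L)) (n : ℕ) :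
    |Real.log (partitionSum p n q) - n * L| ≤ |q| * Real.log C := by
  obtain ⟨L', hL', hle⟩ := exists_tendsto_div_of_quasiAdditive
    (u := fun n => Real.log (partitionSum p n q)) (hp.abs_log_partitionSum_add_le q)
  rw [tendsto_nhds_unique hL hL']
  exact hle n

section Gaussian

variable {T : ℝ → ℝ} {h v : ℝ}

theorem abs_log_sum_mul_exp_deviation_sub_le (hp : IsQuasiMultiplicative p C)
    (hT : ∀ q, Tendsto (fun n : ℕ => Real.log (partitionSum p n q) / n) atTop (𝓝 (T q)))
    {θ : ℝ} (hθ : |θ| ≤ 1) (n : ℕ) :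
    |Real.log (∑ w ∈ posWords p n, p w * Real.exp (θ * deviation p h w)) -
      n * (T (1 - θ) - θ * h)| ≤ 2 * Real.log C := by
  rw [sum_mul_exp_deviation, Real.log_mul (hp.partitionSum_pos _ _).ne' (Real.exp_ne_zero _),
    Real.log_exp, mul_sub, ← sub_eq_add_neg, sub_sub_sub_cancel_right]
  have hq : |1 - θ| ≤ 2 := by
    rw [abs_le] at hθ ⊢
    constructor <;> linarith
  exact (hp.abs_log_partitionSum_sub_le (hT _) n).trans
    (mul_le_mul_of_nonneg_right hq (Real.log_nonneg hp.one_le))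

/-- The error is bounded uniformly in `n`, so that the expansion of `T` at `1` survives at the scale
`θ = t / √n`. -/
theorem eventually_sum_mul_exp_deviation_mem_Icc (hp : IsQuasiMultiplicative p C)
    (hT : ∀ q, Tendsto (fun n : ℕ => Real.log (partitionSum p n q) / n) atTop (𝓝 (T q)))
    (hexp : (fun q : ℝ => T (1 - q) - q * h - v / 2 * q ^ 2) =o[𝓝 0] fun q : ℝ => q ^ 2)
    (t : ℝ) :
    ∀ᶠ n : ℕ in atTop, ∑ w ∈ posWords p n, p w * Real.exp (t / √n * deviation p h w) ∈
      Set.Icc (Real.exp (v / 2 * t ^ 2 - (2 * Real.log C + 1)))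
        (Real.exp (v / 2 * t ^ 2 + (2 * Real.log C + 1))) := by
  have hscale : Tendsto (fun n : ℕ => |t / √n|) atTop (𝓝 0) := by
    simpa using (tendsto_const_nhds.div_atTop tendsto_sqrt_natCast_atTop).abs
  filter_upwards [hscale.eventually_le_const one_pos,
    (tendsto_natCast_mul_comp_div_sqrt hexp t).eventually_mem
      (Metric.closedBall_mem_nhds _ one_pos)] with n hθ hquad
  have hlog := abs_le.1 (hp.abs_log_sum_mul_exp_deviation_sub_le (h := h) hT hθ n)
  have hpos : 0 < ∑ w ∈ posWords p n, p w * Real.exp (t / √n * deviation p h w) := by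
    rw [sum_mul_exp_deviation]
    exact mul_pos (hp.partitionSum_pos _ _) (Real.exp_pos _)
  rw [Metric.mem_closedBall, Real.dist_eq, abs_le] at hquad
  rw [Set.mem_Icc, ← Real.le_log_iff_exp_le hpos, ← Real.log_le_iff_le_exp hpos]
  constructor <;> linarith

theorem exists_pos_eventually_le_sum_deviation (hp : IsQuasiMultiplicative p C) (hv : 0 < v)
    (hT : ∀ q, Tendsto (fun n : ℕ => Real.log (partitionSum p n q) / n) atTop (𝓝 (T q)))
    (hexp : (fun q : ℝ => T (1 - q) - q * h - v / 2 * q ^ 2) =o[𝓝 0] fun q : ℝ => q ^ 2) :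
    (∃ c, 0 < c ∧ ∀ᶠ n : ℕ in atTop, c ≤ ∑ w ∈ posWords p n with √n < deviation p h w, p w) ∧
      ∃ c, 0 < c ∧ ∀ᶠ n : ℕ in atTop, c ≤ ∑ w ∈ posWords p n with √n < -deviation p h w, p w := by
  have hsqrt : ∀ᶠ n : ℕ in atTop, 0 < √(n : ℝ) :=
    tendsto_sqrt_natCast_atTop.eventually_gt_atTop 0
  have htail := fun Y : List A → ℝ => exists_pos_eventually_le_tail (Y := Y) (b := v / 2)
    (K := 2 * Real.log C + 1) hp.nonneg (fun n => (hp.sum_posWords n).le) hsqrt (half_pos hv)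
  have hmoment := hp.eventually_sum_mul_exp_deviation_mem_Icc hT hexp
  refine ⟨htail _ fun t _ => hmoment t, htail _ fun t _ => ?_⟩
  simpa only [neg_div, neg_mul, mul_neg, even_two.neg_pow] using hmoment (-t)

end Gaussian

theorem eventually_le_sum_of_prefix [DecidableEq A] (hp : IsQuasiMultiplicative p C)
    {Y : List A → ℝ} {b c : ℝ} (hY : ∀ u v, 0 < p u → 0 < p v → Y u + Y v - b ≤ Y (u ++ v))
    (hc : ∀ᶠ n : ℕ in atTop, c ≤ ∑ v ∈ posWords p n with √n < Y v, p v) (u : List A) :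
    ∀ᶠ n : ℕ in atTop, c / C * p u ≤ ∑ w ∈ posWords p n with u <+: w ∧ √n / 2 < Y w, p w := by
  rcases (hp.nonneg u).eq_or_lt with hu | hu
  · refine .of_forall fun n => ?_
    rw [← hu, mul_zero]
    exact Finset.sum_nonneg fun w _ => hp.nonneg w
  have hC : 0 < C := zero_lt_one.trans_le hp.one_le
  have hlarge : ∀ᶠ k : ℕ in atTop, 2 * (b - Y u) + √u.length ≤ √k :=
    tendsto_sqrt_natCast_atTop.eventually_ge_atTop _
  rw [← map_add_atTop_eq_nat u.length, eventually_map]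
  filter_upwards [hc, hlarge] with k hck hk
  calc c / C * p u ≤ (∑ v ∈ posWords p k with √k < Y v, p v) / C * p u := by gcongr
    _ = ∑ v ∈ posWords p k with √k < Y v, 1 / C * (p u * p v) := by
        rw [Finset.sum_div, Finset.sum_mul]
        exact Finset.sum_congr rfl fun v _ => by ring
    _ ≤ ∑ v ∈ posWords p k with √k < Y v, p (u ++ v) :=
        Finset.sum_le_sum fun v _ => hp.le_append u v
    _ = ∑ w ∈ {v ∈ posWords p k | √k < Y v}.image (u ++ ·), p w :=
        (Finset.sum_image fun v _ w _ => List.append_cancel_left).symm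
    _ ≤ _ := by
        refine Finset.sum_le_sum_of_subset_of_nonneg (Finset.image_subset_iff.2 fun v hv => ?_)
          fun w _ _ => hp.nonneg w
        obtain ⟨hvk, hYv⟩ := Finset.mem_filter.1 hv
        obtain ⟨hlen, hpv⟩ := mem_posWords.1 hvk
        refine Finset.mem_filter.2 ⟨mem_posWords.2 ⟨?_, hp.append_pos_iff.2 ⟨hu, hpv⟩⟩,
          List.prefix_append u v, ?_⟩
        · rw [List.length_append, hlen, add_comm]
        · have hsqrt : √((k + u.length : ℕ) : ℝ) ≤ √k + √u.length := by
            push_cast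
            refine Real.sqrt_le_iff.2 ⟨by positivity, ?_⟩
            rw [add_sq, Real.sq_sqrt (Nat.cast_nonneg _), Real.sq_sqrt (Nat.cast_nonneg _)]
            linarith [show 0 ≤ 2 * √(k : ℝ) * √u.length by positivity]
          linarith [hY u v hu hpv]

end IsQuasiMultiplicative

end Words

section FiniteMeasure

variable {X : Type*} [MeasurableSpace X] {μ : Measure X}

theorem le_measure_limsup_of_frequently_le [IsFiniteMeasure μ] {s : ℕ → Set X}
    (hs : ∀ n, MeasurableSet (s n)) {c : ℝ≥0∞} (hc : ∃ᶠ n in atTop, c ≤ μ (s n)) :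
    c ≤ μ (limsup s atTop) := by
  have hanti : Antitone fun N => ⋃ n ≥ N, s n := fun N N' hN =>
    Set.biUnion_subset_biUnion_left fun n hn => hN.trans hn
  have hlim := tendsto_measure_iInter_atTop (μ := μ)
    (fun N => (MeasurableSet.biUnion (Set.to_countable {n | n ≥ N})
      fun n _ => hs n).nullMeasurableSet) hanti ⟨0, measure_ne_top μ _⟩
  rw [limsup_eq_iInf_iSup_of_nat]
  refine ge_of_tendsto' hlim fun N => ?_
  obtain ⟨n, hn, hcn⟩ := frequently_atTop.1 hc N
  exact hcn.trans (measure_mono (Set.subset_biUnion_of_mem (u := s) hn))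

theorem sum_measure_le_mul_of_card_filter_le {ι : Type*} {F : Finset ι} {t : ι → Set X}
    [∀ x, DecidablePred (x ∈ t ·)] (ht : ∀ i ∈ F, MeasurableSet (t i)) {K : ℕ}
    (hK : ∀ x, {i ∈ F | x ∈ t i}.card ≤ K) : ∑ i ∈ F, μ (t i) ≤ K * μ Set.univ :=
  calc ∑ i ∈ F, μ (t i) = ∑ i ∈ F, ∫⁻ x, (t i).indicator 1 x ∂μ :=
        Finset.sum_congr rfl fun i hi => (lintegral_indicator_one (ht i hi)).symm
    _ = ∫⁻ x, ∑ i ∈ F, (t i).indicator 1 x ∂μ :=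
        (lintegral_finsetSum' _ fun i hi =>
          (measurable_one.indicator (ht i hi)).aemeasurable).symm
    _ ≤ ∫⁻ _, K ∂μ := by
        refine lintegral_mono fun x => ?_
        classical
        simp only [Set.indicator_apply, Pi.one_apply, Finset.sum_boole]
        refine Nat.cast_le.2 (le_of_eq_of_le ?_ (hK x))
        congr
    _ = K * μ Set.univ := lintegral_const _

theorem measure_biUnion_filter_le_mul {ι : Type*} (F : Finset ι) (s t : ι → Set X) (ε : ℝ≥0∞) :
    μ (⋃ i ∈ {i ∈ F | μ (s i) ≤ ε * μ (t i)}, s i) ≤ ε * ∑ i ∈ F, μ (t i) :=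
  calc μ (⋃ i ∈ {i ∈ F | μ (s i) ≤ ε * μ (t i)}, s i)
      ≤ ∑ i ∈ F with μ (s i) ≤ ε * μ (t i), μ (s i) := measure_biUnion_finset_le _ _
    _ ≤ ∑ i ∈ F with μ (s i) ≤ ε * μ (t i), ε * μ (t i) :=
        Finset.sum_le_sum fun _ hi => (Finset.mem_filter.1 hi).2
    _ ≤ ∑ i ∈ F, ε * μ (t i) := Finset.sum_le_sum_of_subset (Finset.filter_subset _ _)
    _ = ε * ∑ i ∈ F, μ (t i) := (Finset.mul_sum ..).symm

end FiniteMeasure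

section Cells

variable {X ι : Type*} [PseudoMetricSpace X] [MeasurableSpace X] [Countable ι] {μ ν : Measure X}
  {W : ℕ → Set ι} {s : ι → Set X} {r : ℕ → ℝ}

theorem measure_le_of_isOpen_of_forall_cell_le (hs : ∀ i, MeasurableSet (s i))
    (hdisj : ∀ n, (W n).PairwiseDisjoint s) (hcover : ∀ n, ∀ᵐ x ∂μ, ∃ i ∈ W n, x ∈ s i)
    (hdist : ∀ n, ∀ i ∈ W n, ∀ x ∈ s i, ∀ y ∈ s i, dist x y ≤ r n)
    (hr : Tendsto r atTop (𝓝 0)) (hle : ∀ i, μ (s i) ≤ ν (s i)) {U : Set X} (hU : IsOpen U) :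
    μ U ≤ ν U := by
  let V : ℕ → Set X := fun n => ⋃ i ∈ {i ∈ W n | s i ⊆ U}, s i
  have hV : ∀ n, μ (V n) ≤ ν U := fun n =>
    calc μ (V n) ≤ ∑' i : {i ∈ W n | s i ⊆ U}, μ (s i) :=
          measure_biUnion_le μ (Set.to_countable _) s
      _ ≤ ∑' i : {i ∈ W n | s i ⊆ U}, ν (s i) := ENNReal.tsum_le_tsum fun i => hle i
      _ = ν (V n) := (measure_biUnion (Set.to_countable _)
          ((hdisj n).subset (Set.sep_subset _ _)) fun i _ => hs i).symm
      _ ≤ ν U := measure_mono (Set.iUnion₂_subset fun i hi => hi.2)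
  have hmem : ∀ᵐ x ∂μ, x ∈ U → ∀ᶠ n in atTop, x ∈ V n := by
    filter_upwards [ae_all_iff.2 hcover] with x hx hxU
    obtain ⟨ρ, hρ, hball⟩ := Metric.isOpen_iff.1 hU x hxU
    filter_upwards [hr.eventually_lt_const hρ] with n hn
    obtain ⟨i, hi, hxi⟩ := hx n
    refine Set.mem_biUnion (x := i) ⟨hi, fun y hy => hball ?_⟩ hxi
    exact Metric.mem_ball.2 ((hdist n i hi y hy x hxi).trans_lt hn)
  have hmono : Monotone fun N => ⋂ n ≥ N, V n := fun N N' hN =>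
    Set.biInter_subset_biInter_left fun n hn => le_trans hN hn
  calc μ U ≤ μ (⋃ N, ⋂ n ≥ N, V n) := by
        refine measure_mono_ae ?_
        filter_upwards [hmem] with x hx hxU
        obtain ⟨N, hN⟩ := eventually_atTop.1 (hx hxU)
        exact Set.mem_iUnion.2 ⟨N, Set.mem_iInter₂.2 hN⟩
    _ = ⨆ N, μ (⋂ n ≥ N, V n) := hmono.measure_iUnion
    _ ≤ ν U := iSup_le fun N =>
        (measure_mono (Set.biInter_subset_of_mem (le_refl N))).trans (hV N)

theorem measure_le_of_forall_cell_le [ν.OuterRegular] (hs : ∀ i, MeasurableSet (s i))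
    (hdisj : ∀ n, (W n).PairwiseDisjoint s) (hcover : ∀ n, ∀ᵐ x ∂μ, ∃ i ∈ W n, x ∈ s i)
    (hdist : ∀ n, ∀ i ∈ W n, ∀ x ∈ s i, ∀ y ∈ s i, dist x y ≤ r n)
    (hr : Tendsto r atTop (𝓝 0)) (hle : ∀ i, μ (s i) ≤ ν (s i)) : μ ≤ ν := by
  refine Measure.le_intro fun B _ _ => ?_
  rw [B.measure_eq_iInf_isOpen ν]
  exact le_iInf₂ fun U hBU => le_iInf fun hU => (measure_mono hBU).trans
    (measure_le_of_isOpen_of_forall_cell_le hs hdisj hcover hdist hr hle hU)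

/-- A substitute for the Lebesgue density theorem. -/
theorem ae_mem_of_forall_mul_cell_le [BorelSpace X] [IsFiniteMeasure μ]
    (hs : ∀ i, MeasurableSet (s i)) (hdisj : ∀ n, (W n).PairwiseDisjoint s)
    (hcover : ∀ n, ∀ᵐ x ∂μ, ∃ i ∈ W n, x ∈ s i)
    (hdist : ∀ n, ∀ i ∈ W n, ∀ x ∈ s i, ∀ y ∈ s i, dist x y ≤ r n)
    (hr : Tendsto r atTop (𝓝 0)) {B : Set X} (hB : MeasurableSet B) {c : ℝ≥0∞} (hc : c ≠ 0)
    (hle : ∀ i, c * μ (s i) ≤ μ (B ∩ s i)) : ∀ᵐ x ∂μ, x ∈ B := by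
  have hcμ : c • μ ≤ μ.restrict B := by
    refine measure_le_of_forall_cell_le hs hdisj (fun n => Measure.ae_smul_measure (hcover n) c)
      hdist hr fun i => ?_
    rw [Measure.restrict_apply (hs i), Set.inter_comm]
    exact hle i
  have hcompl := hcμ Bᶜ
  rw [Measure.restrict_apply hB.compl, Set.compl_inter_self, measure_empty, nonpos_iff_eq_zero,
    Measure.smul_apply, smul_eq_mul, mul_eq_zero] at hcompl
  exact hcompl.resolve_left hc

end Cells

section Packing

variable {X : Type*} [PseudoMetricSpace X]

theorem exists_countable_disjoint_closedBall_cover [TopologicalSpace.SeparableSpace X] {E : Set X}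
    {δ : ℝ} {P : X → ℝ → Prop} (h : ∀ x ∈ E, ∃ r, 0 < r ∧ r ≤ δ ∧ P x r) :
    ∃ u : Set (X × ℝ), u.Countable ∧
      (∀ p ∈ u, p.1 ∈ E ∧ 0 < p.2 ∧ p.2 ≤ δ ∧ P p.1 p.2) ∧
      u.PairwiseDisjoint (fun p => Metric.closedBall p.1 p.2) ∧
      E ⊆ ⋃ p ∈ u, Metric.closedBall p.1 (5 * p.2) := by
  obtain ⟨u, hu, hdisj, hcover⟩ := Vitali.exists_disjoint_subfamily_covering_enlargement_closedBall
    {p : X × ℝ | p.1 ∈ E ∧ 0 < p.2 ∧ p.2 ≤ δ ∧ P p.1 p.2} Prod.fst Prod.snd δ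
    (fun p hp => hp.2.2.1) 5 (by norm_num)
  refine ⟨u, hdisj.countable_of_nonempty_interior fun p hp => ⟨p.1, ?_⟩, hu, hdisj, fun x hx => ?_⟩
  · exact Metric.ball_subset_interior_closedBall (Metric.mem_ball_self (hu hp).2.1)
  · obtain ⟨r, hr, hrδ, hP⟩ := h x hx
    obtain ⟨p, hp, hsub⟩ := hcover (x, r) ⟨hx, hr, hrδ, hP⟩
    exact Set.mem_biUnion hp (hsub (Metric.mem_closedBall_self hr.le))

theorem packingAt_mono (s δ : ℝ) {E F : Set X} (hEF : E ⊆ F) : packingAt s δ E ≤ packingAt s δ F :=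
  iSup_mono fun _ => iSup_mono' fun hu => ⟨fun p hp => ⟨hEF (hu p hp).1, (hu p hp).2⟩, le_rfl⟩

end Packing

section Densities

variable {X : Type*} [MeasurableSpace X]

/-- The lower `s`-density of `μ` at `x`, that is the lower limit of `μ (closedBall x r) / r ^ s` as
`r` decreases to `0`, vanishes. -/
def HasZeroLowerDensity [PseudoMetricSpace X] (μ : Measure X) (s : ℝ) (x : X) : Prop :=
  ∀ η > 0, ∃ᶠ r in 𝓝[>] 0, μ (Metric.closedBall x r) ≤ ENNReal.ofReal (η * r ^ s)

/-- The upper `s`-density of `μ` at `x`, that is the upper limit of `μ (closedBall x r) / r ^ s` as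
`r` decreases to `0`, is infinite. -/
def HasInfiniteUpperDensity [PseudoMetricSpace X] (μ : Measure X) (s : ℝ) (x : X) : Prop :=
  ∀ K, ∃ᶠ r in 𝓝[>] 0, ENNReal.ofReal (K * r ^ s) ≤ μ (Metric.closedBall x r)

section PseudoMetricSpace

variable [PseudoMetricSpace X] {μ : Measure X} {s : ℝ}

theorem HasZeroLowerDensity.exists_closedBall_le {x : X} (hx : HasZeroLowerDensity μ s x)
    {η δ : ℝ} (hη : 0 < η) (hδ : 0 < δ) :
    ∃ r, 0 < r ∧ r ≤ δ ∧
      μ (Metric.closedBall x (5 * r)) ≤ ENNReal.ofReal η * ENNReal.ofReal (2 * r) ^ s := by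
  obtain ⟨r, hμ, hr, hrδ⟩ := ((hx (η * (2 / 5) ^ s) (by positivity)).and_eventually
    (Ioc_mem_nhdsGT (show 0 < 5 * δ by positivity))).exists
  refine ⟨r / 5, by positivity, by linarith, ?_⟩
  have hscale : η * (2 / 5) ^ s * r ^ s = η * (2 * (r / 5)) ^ s := by
    rw [mul_assoc, ← Real.mul_rpow (by norm_num) hr.le]
    ring_nf
  rwa [mul_div_cancel₀ r (by norm_num), ENNReal.ofReal_rpow_of_pos (by positivity),
    ← ENNReal.ofReal_mul hη.le, ← hscale]

theorem measure_le_mul_packingAt [TopologicalSpace.SeparableSpace X] {η δ : ℝ} (hη : 0 < η)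
    (hδ : 0 < δ) {E : Set X} (hE : ∀ x ∈ E, HasZeroLowerDensity μ s x) :
    μ E ≤ ENNReal.ofReal η * packingAt s δ E := by
  obtain ⟨u, hcount, hu, hdisj, hcover⟩ := exists_countable_disjoint_closedBall_cover
    fun x hx => (hE x hx).exists_closedBall_le hη hδ
  calc μ E ≤ μ (⋃ p ∈ u, Metric.closedBall p.1 (5 * p.2)) := measure_mono hcover
    _ ≤ ∑' p : u, μ (Metric.closedBall p.1.1 (5 * p.1.2)) := measure_biUnion_le μ hcount _
    _ ≤ ∑' p : u, ENNReal.ofReal η * ENNReal.ofReal (2 * p.1.2) ^ s :=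
        ENNReal.tsum_le_tsum fun p => (hu p p.2).2.2.2
    _ = ENNReal.ofReal η * ∑' p : u, ENNReal.ofReal (2 * p.1.2) ^ s := ENNReal.tsum_mul_left
    _ ≤ ENNReal.ofReal η * packingAt s δ E := by
        gcongr
        exact le_iSup₂_of_le u (fun p hp => ⟨(hu p hp).1, (hu p hp).2.1, (hu p hp).2.2.1⟩)
          (le_iSup_of_le hdisj le_rfl)

theorem measure_eq_zero_of_packingPreMeasure_lt_top [TopologicalSpace.SeparableSpace X]
    (hμ : ∀ᵐ x ∂μ, HasZeroLowerDensity μ s x) {E : Set X} (hE : packingPreMeasure s E < ∞) :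
    μ E = 0 := by
  simp only [packingPreMeasure, iInf_lt_iff] at hE
  obtain ⟨δ, hδ, hfin⟩ := hE
  have hle : ∀ η > 0, μ (E ∩ {x | HasZeroLowerDensity μ s x}) ≤
      ENNReal.ofReal η * packingAt s δ E := fun η hη =>
    (measure_le_mul_packingAt hη hδ fun x hx => hx.2).trans
      (mul_le_mul_right (packingAt_mono s δ Set.inter_subset_left) _)
  have hlim : Tendsto (fun η => ENNReal.ofReal η * packingAt s δ E) (𝓝[>] 0) (𝓝 0) := by
    have hη : Tendsto ENNReal.ofReal (𝓝[>] 0) (𝓝 0) := by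
      simpa using (ENNReal.continuous_ofReal.tendsto 0).mono_left nhdsWithin_le_nhds
    simpa using ENNReal.Tendsto.mul_const hη (.inr hfin.ne)
  have hmem : ∀ᵐ x ∂μ, x ∈ {x | HasZeroLowerDensity μ s x} := hμ
  rw [← Measure.measure_inter_eq_of_ae hmem, Set.inter_comm]
  exact le_antisymm (ge_of_tendsto hlim (eventually_mem_nhdsWithin.mono hle)) bot_le

theorem measure_eq_zero_of_packingMeasure_lt_top [TopologicalSpace.SeparableSpace X]
    (hμ : ∀ᵐ x ∂μ, HasZeroLowerDensity μ s x) {E : Set X} (hE : packingMeasure X s E < ∞) :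
    μ E = 0 := by
  simp only [packingMeasure, OuterMeasure.ofFunction_apply, iInf_lt_iff] at hE
  obtain ⟨t, hEt, hsum⟩ := hE
  refine measure_mono_null hEt (measure_iUnion_null fun n => ?_)
  exact measure_eq_zero_of_packingPreMeasure_lt_top hμ ((ENNReal.le_tsum n).trans_lt hsum)

theorem HasInfiniteUpperDensity.exponent_pos [IsFiniteMeasure μ] {x : X}
    (hx : HasInfiniteUpperDensity μ s x) : 0 < s := by
  by_contra! hs
  obtain ⟨r, hle, hr, hr1⟩ :=
    ((hx (μ.real Set.univ + 1)).and_eventually (Ioc_mem_nhdsGT one_pos)).exists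
  have hreal : (μ.real Set.univ + 1) * r ^ s ≤ μ.real Set.univ := by
    refine (ENNReal.ofReal_le_ofReal_iff measureReal_nonneg).1 (hle.trans ?_)
    rw [ofReal_measureReal]
    exact measure_mono (Set.subset_univ _)
  have hone : 1 ≤ r ^ s := Real.one_le_rpow_of_pos_of_le_one_of_nonpos hr hr1 hs
  linarith [le_mul_of_one_le_right (by positivity : 0 ≤ μ.real Set.univ + 1) hone]

theorem exists_cover_tsum_ediam_rpow_le [TopologicalSpace.SeparableSpace X]
    [OpensMeasurableSpace X] (hs : 0 < s) {E : Set X}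
    (hE : ∀ x ∈ E, HasInfiniteUpperDensity μ s x) {K δ : ℝ} (hK : 0 < K) (hδ : 0 < δ) :
    ∃ u : Set (X × ℝ), u.Countable ∧
      (∀ p ∈ u, Metric.ediam (Metric.closedBall p.1 (5 * p.2)) ≤ ENNReal.ofReal (10 * δ)) ∧
      E ⊆ ⋃ p ∈ u, Metric.closedBall p.1 (5 * p.2) ∧
      ∑' p : u, Metric.ediam (Metric.closedBall p.1.1 (5 * p.1.2)) ^ s ≤
        ENNReal.ofReal (10 ^ s / K) * μ Set.univ := by
  obtain ⟨u, hcount, hu, hdisj, hcover⟩ := exists_countable_disjoint_closedBall_cover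
    (P := fun x r => ENNReal.ofReal (K * r ^ s) ≤ μ (Metric.closedBall x r)) (δ := δ)
    fun x hx => by
      obtain ⟨r, hle, hr, hrδ⟩ := ((hE x hx K).and_eventually (Ioc_mem_nhdsGT hδ)).exists
      exact ⟨r, hr, hrδ, hle⟩
  have hdiam : ∀ p : X × ℝ, Metric.ediam (Metric.closedBall p.1 (5 * p.2)) ≤
      ENNReal.ofReal (10 * p.2) := fun p => by
    refine Metric.ediam_le fun x hx y hy => ?_
    rw [edist_dist]
    refine ENNReal.ofReal_le_ofReal ((dist_triangle_right x y p.1).trans ?_)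
    linarith [Metric.mem_closedBall.1 hx, Metric.mem_closedBall.1 hy]
  refine ⟨u, hcount, fun p hp => (hdiam p).trans (ENNReal.ofReal_le_ofReal ?_), hcover, ?_⟩
  · linarith [(hu p hp).2.2.1]
  have hterm : ∀ p : u, Metric.ediam (Metric.closedBall p.1.1 (5 * p.1.2)) ^ s ≤
      ENNReal.ofReal (10 ^ s / K) * μ (Metric.closedBall p.1.1 p.1.2) := fun p => by
    obtain ⟨-, hr, -, hle⟩ := hu p p.2
    calc _ ≤ ENNReal.ofReal (10 * p.1.2) ^ s := by gcongr; exact hdiam p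
      _ = ENNReal.ofReal (10 ^ s / K) * ENNReal.ofReal (K * p.1.2 ^ s) := by
          rw [ENNReal.ofReal_rpow_of_pos (by positivity), ← ENNReal.ofReal_mul (by positivity),
            Real.mul_rpow (by norm_num) hr.le, ← mul_assoc, div_mul_cancel₀ _ hK.ne']
      _ ≤ _ := by gcongr
  calc _ ≤ ∑' p : u, ENNReal.ofReal (10 ^ s / K) * μ (Metric.closedBall p.1.1 p.1.2) :=
        ENNReal.tsum_le_tsum hterm
    _ = ENNReal.ofReal (10 ^ s / K) * μ (⋃ p ∈ u, Metric.closedBall p.1 p.2) := by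
        rw [ENNReal.tsum_mul_left, measure_biUnion hcount hdisj
          fun p _ => Metric.isClosed_closedBall.measurableSet]
    _ ≤ _ := by gcongr; exact Set.subset_univ _

end PseudoMetricSpace

section MetricSpace

variable [MetricSpace X] [TopologicalSpace.SeparableSpace X] [BorelSpace X] {μ : Measure X} {s : ℝ}

theorem hausdorffMeasure_eq_zero_of_hasInfiniteUpperDensity [IsFiniteMeasure μ] {E : Set X}
    (hE : ∀ x ∈ E, HasInfiniteUpperDensity μ s x) : Measure.hausdorffMeasure s E = 0 := by
  rcases E.eq_empty_or_nonempty with rfl | ⟨x, hx⟩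
  · exact measure_empty
  have hs : 0 < s := (hE x hx).exponent_pos
  choose u hcount hdiam hcover hsum using fun n : ℕ =>
    exists_cover_tsum_ediam_rpow_le hs hE (Nat.cast_add_one_pos n) (Nat.one_div_pos_of_nat (n := n))
  have : ∀ n, Countable (u n) := fun n => (hcount n).to_subtype
  have hmesh : Tendsto (fun n : ℕ => ENNReal.ofReal (10 * (1 / ((n : ℝ) + 1)))) atTop (𝓝 0) := by
    simpa using ENNReal.tendsto_ofReal (tendsto_one_div_add_atTop_nhds_zero_nat.const_mul (10 : ℝ))
  have hbound : Tendsto (fun n : ℕ => ENNReal.ofReal (10 ^ s / ((n : ℝ) + 1)) * μ Set.univ) atTop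
      (𝓝 0) := by
    have hdiv : Tendsto (fun n : ℕ => 10 ^ s / ((n : ℝ) + 1)) atTop (𝓝 0) := by
      simpa [div_eq_mul_inv] using tendsto_one_div_add_atTop_nhds_zero_nat.const_mul ((10 : ℝ) ^ s)
    simpa using ENNReal.Tendsto.mul_const (ENNReal.tendsto_ofReal hdiv)
      (.inr (measure_ne_top μ Set.univ))
  have hle := Measure.hausdorffMeasure_le_liminf_tsum s E _ hmesh
    (fun n (p : u n) => Metric.closedBall p.1.1 (5 * p.1.2))
    (.of_forall fun n p => hdiam n p p.2)
    (.of_forall fun n => (hcover n).trans_eq (Set.biUnion_eq_iUnion ..))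
  refine le_antisymm (hle.trans ?_) bot_le
  exact (liminf_le_liminf (.of_forall hsum)).trans_eq hbound.liminf_eq

theorem exists_measurableSet_hausdorffMeasure_eq_zero [IsProbabilityMeasure μ]
    (hμ : ∀ᵐ x ∂μ, HasInfiniteUpperDensity μ s x) :
    ∃ E, MeasurableSet E ∧ μ E = 1 ∧ Measure.hausdorffMeasure s E = 0 := by
  obtain ⟨t, hsub, htm, ht0⟩ := exists_measurable_superset_of_null hμ
  refine ⟨tᶜ, htm.compl, (prob_compl_eq_one_iff htm).2 ht0, ?_⟩
  exact hausdorffMeasure_eq_zero_of_hasInfiniteUpperDensity (μ := μ) fun x hx =>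
    not_not.1 fun h => hx (hsub h)

end MetricSpace

end Densities

section LadicCubes

variable {ℓ D n : ℕ} {k k' : Fin D → Fin (ℓ ^ n)} {x y : EuclideanSpace ℝ (Fin D)}

theorem mem_ladicCube_iff_floor (hℓ : 0 < ℓ) :
    x ∈ ladicCube ℓ D n k ↔ ∀ i, ⌊x i * (ℓ : ℝ) ^ n⌋ = (k i : ℕ) := by
  have hpos : (0 : ℝ) < (ℓ : ℝ) ^ n := by positivity
  refine forall_congr' fun i => ?_
  rw [div_le_iff₀ hpos, lt_div_iff₀ hpos, Int.floor_eq_iff, Int.cast_natCast]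

theorem eq_of_mem_ladicCube (hℓ : 0 < ℓ) (hk : x ∈ ladicCube ℓ D n k)
    (hk' : x ∈ ladicCube ℓ D n k') : k = k' := by
  rw [mem_ladicCube_iff_floor hℓ] at hk hk'
  exact funext fun i => Fin.ext (Int.ofNat_inj.1 ((hk i).symm.trans (hk' i)))

theorem exists_mem_ladicCube (hℓ : 0 < ℓ) (n : ℕ) (hx : x ∈ unitCube D) :
    ∃ k, x ∈ ladicCube ℓ D n k := by
  have hpos : (0 : ℝ) < (ℓ : ℝ) ^ n := by positivity
  have hlt : ∀ i, ⌊x i * (ℓ : ℝ) ^ n⌋₊ < ℓ ^ n := fun i => by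
    rw [Nat.floor_lt (mul_nonneg (hx i).1 hpos.le), Nat.cast_pow]
    exact mul_lt_of_lt_one_left hpos (hx i).2
  refine ⟨fun i => ⟨_, hlt i⟩, (mem_ladicCube_iff_floor hℓ).2 fun i => ?_⟩
  exact (Int.natCast_floor_eq_floor (mul_nonneg (hx i).1 hpos.le)).symm

theorem ladicCube_injective (hℓ : 0 < ℓ) : Function.Injective (ladicCube ℓ D n) := by
  have hpos : (0 : ℝ) < (ℓ : ℝ) ^ n := by positivity
  intro k k' h
  have hcorner : WithLp.toLp 2 (fun i => ((k i : ℕ) : ℝ) / (ℓ : ℝ) ^ n) ∈ ladicCube ℓ D n k :=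
    fun i => ⟨le_rfl, div_lt_div_of_pos_right (lt_add_one _) hpos⟩
  exact eq_of_mem_ladicCube hℓ hcorner (h ▸ hcorner)

theorem measurableSet_unitCube : MeasurableSet (unitCube D) := by
  unfold unitCube
  measurability

theorem measurableSet_ladicCube (k : Fin D → Fin (ℓ ^ n)) : MeasurableSet (ladicCube ℓ D n k) := by
  unfold ladicCube
  measurability

theorem dist_le_of_mem_ladicCube (hx : x ∈ ladicCube ℓ D n k) (hy : y ∈ ladicCube ℓ D n k) :
    dist x y ≤ √D * ((ℓ : ℝ) ^ n)⁻¹ := by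
  have hcoord : ∀ i, dist (x i) (y i) ≤ ((ℓ : ℝ) ^ n)⁻¹ := fun i => by
    have hxi := hx i
    have hyi := hy i
    rw [add_div, one_div] at hxi hyi
    rw [Real.dist_eq, abs_le]
    constructor <;> linarith [hxi.1, hxi.2, hyi.1, hyi.2]
  rw [EuclideanSpace.dist_eq, Real.sqrt_le_left (by positivity), mul_pow,
    Real.sq_sqrt (Nat.cast_nonneg D)]
  calc ∑ i, dist (x i) (y i) ^ 2 ≤ ∑ _i : Fin D, ((ℓ : ℝ) ^ n)⁻¹ ^ 2 := by
        gcongr with i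
        exact hcoord i
    _ = D * ((ℓ : ℝ) ^ n)⁻¹ ^ 2 := by rw [Fin.sum_const, nsmul_eq_mul]

/-- The union of the cubes of generation `n`, in the grid of the whole space, that touch the cube of
index `k`. It contains the balls of radius `ℓ ^ (-n)` centred in that cube. -/
def cubeNeighborhood (ℓ D n : ℕ) (k : Fin D → Fin (ℓ ^ n)) : Set (EuclideanSpace ℝ (Fin D)) :=
  {y | ∀ i, |⌊y i * (ℓ : ℝ) ^ n⌋ - (k i : ℕ)| ≤ 1}

theorem measurableSet_cubeNeighborhood (k : Fin D → Fin (ℓ ^ n)) :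
    MeasurableSet (cubeNeighborhood ℓ D n k) := by
  unfold cubeNeighborhood
  measurability

theorem closedBall_subset_cubeNeighborhood (hℓ : 0 < ℓ) (hx : x ∈ ladicCube ℓ D n k) :
    Metric.closedBall x ((ℓ : ℝ) ^ n)⁻¹ ⊆ cubeNeighborhood ℓ D n k := by
  intro y hy i
  have hpos : (0 : ℝ) < (ℓ : ℝ) ^ n := by positivity
  have hcoord : |y i - x i| ≤ ((ℓ : ℝ) ^ n)⁻¹ :=
    (PiLp.norm_apply_le (y - x) i).trans ((dist_eq_norm y x).symm.trans_le hy)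
  have hscaled : |y i * (ℓ : ℝ) ^ n - x i * (ℓ : ℝ) ^ n| ≤ 1 := by
    rwa [← sub_mul, abs_mul, abs_of_pos hpos, ← le_div_iff₀ hpos, one_div]
  rw [← (mem_ladicCube_iff_floor hℓ).1 hx i]
  obtain ⟨hlo, hhi⟩ := abs_le.1 hscaled
  have hle := Int.floor_mono (show y i * (ℓ : ℝ) ^ n ≤ x i * (ℓ : ℝ) ^ n + 1 by linarith)
  have hge := Int.floor_mono (show x i * (ℓ : ℝ) ^ n ≤ y i * (ℓ : ℝ) ^ n + 1 by linarith)
  rw [Int.floor_add_one] at hle hge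
  rw [abs_le]
  constructor <;> linarith

theorem card_filter_abs_sub_le_one (N : ℕ) (z : ℤ) :
    (Finset.univ.filter fun j : Fin N => |z - (j : ℕ)| ≤ 1).card ≤ 3 :=
  calc _ ≤ (Finset.Icc (z - 1) (z + 1)).card := by
        refine Finset.card_le_card_of_injOn (fun j : Fin N => ((j : ℕ) : ℤ)) (fun j hj => ?_) ?_
        · have hj' := abs_le.1 (Finset.mem_filter.1 hj).2
          exact Finset.mem_Icc.2 ⟨by linarith [hj'.2], by linarith [hj'.1]⟩
        · exact fun i _ j _ hij => Fin.ext (Int.ofNat_inj.1 hij)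
    _ = 3 := by
        rw [Int.card_Icc]
        ring_nf
        rfl

open Classical in
theorem card_filter_mem_cubeNeighborhood_le (ℓ n : ℕ) (y : EuclideanSpace ℝ (Fin D)) :
    (Finset.univ.filter fun k => y ∈ cubeNeighborhood ℓ D n k).card ≤ 3 ^ D := by
  have hpi : (Finset.univ.filter fun k => y ∈ cubeNeighborhood ℓ D n k) =
      Fintype.piFinset fun i =>
        Finset.univ.filter fun j : Fin (ℓ ^ n) => |⌊y i * (ℓ : ℝ) ^ n⌋ - (j : ℕ)| ≤ 1 := by
    ext k
    rw [Finset.mem_filter_univ, Fintype.mem_piFinset]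
    exact forall_congr' fun i => by rw [Finset.mem_filter_univ]
  calc _ ≤ ∏ _i : Fin D, 3 := by
        rw [hpi, Fintype.card_piFinset]
        exact Finset.prod_le_prod' fun i _ => card_filter_abs_sub_le_one _ _
    _ = 3 ^ D := Fin.prod_const D 3

/-- The cubes violating the inequality in generation `n` have total mass at most `3 ^ D * ε n`,
because their neighborhoods have bounded overlap. -/
theorem ae_eventually_mul_closedBall_le_ladicCube (hℓ : 0 < ℓ)
    (μ : Measure (EuclideanSpace ℝ (Fin D))) [IsFiniteMeasure μ] {ε : ℕ → ℝ≥0∞}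
    (hε : ∑' n, ε n ≠ ∞) :
    ∀ᵐ x ∂μ, ∀ᶠ n in atTop, ∀ k, x ∈ ladicCube ℓ D n k →
      ε n * μ (Metric.closedBall x ((ℓ : ℝ) ^ n)⁻¹) ≤ μ (ladicCube ℓ D n k) := by
  classical
  let light : ∀ n, Finset (Fin D → Fin (ℓ ^ n)) := fun n =>
    {k | μ (ladicCube ℓ D n k) ≤ ε n * μ (cubeNeighborhood ℓ D n k)}
  have hlight : ∀ n, μ (⋃ k ∈ light n, ladicCube ℓ D n k) ≤ ε n * ((3 ^ D : ℕ) * μ Set.univ) :=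
    fun n => (measure_biUnion_filter_le_mul _ _ _ _).trans <| by
      gcongr
      exact sum_measure_le_mul_of_card_filter_le (fun k _ => measurableSet_cubeNeighborhood k)
        fun y => card_filter_mem_cubeNeighborhood_le ℓ n y
  have hsum : ∑' n, μ (⋃ k ∈ light n, ladicCube ℓ D n k) ≠ ∞ := by
    refine ne_top_of_le_ne_top ?_ (ENNReal.tsum_le_tsum hlight)
    rw [ENNReal.tsum_mul_right]
    finiteness
  filter_upwards [ae_eventually_notMem hsum] with x hx
  filter_upwards [hx] with n hn k hk
  by_contra! hlt
  refine hn (Set.mem_biUnion (Finset.mem_coe.2 (Finset.mem_filter_univ k |>.2 ?_)) hk)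
  exact hlt.le.trans (mul_le_mul_right (measure_mono (closedBall_subset_cubeNeighborhood hℓ hk)) _)

end LadicCubes

theorem tendsto_inv_pow_nhdsGT_zero {ℓ : ℕ} (hℓ : 1 < ℓ) :
    Tendsto (fun n : ℕ => ((ℓ : ℝ) ^ n)⁻¹) atTop (𝓝[>] 0) :=
  tendsto_inv_atTop_nhdsGT_zero.comp (tendsto_pow_atTop_atTop_of_one_lt (Nat.one_lt_cast.2 hℓ))

theorem summable_exp_neg_mul_sqrt {c : ℝ} (hc : 0 < c) :
    Summable fun n : ℕ => Real.exp (-c * √n) := by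
  have hexp : (fun n : ℕ => Real.exp (-c * √n)) =O[atTop] fun n : ℕ => √(n : ℝ) ^ (-4 : ℝ) :=
    ((isLittleO_exp_neg_mul_rpow_atTop hc (-4)).comp_tendsto tendsto_sqrt_natCast_atTop).isBigO
  refine summable_of_isBigO_nat (Real.summable_nat_rpow_inv.2 one_lt_two) (hexp.congr_right ?_)
  intro n
  rw [Real.sqrt_eq_rpow, ← Real.rpow_mul n.cast_nonneg, ← Real.rpow_neg n.cast_nonneg]
  norm_num

namespace IsCubeCoding

variable {ℓ D : ℕ} {I : List (Fin (ℓ ^ D)) → Set (EuclideanSpace ℝ (Fin D))}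

theorem exists_ladicCube_eq (hI : IsCubeCoding ℓ D I) (w : List (Fin (ℓ ^ D))) :
    ∃ k, ladicCube ℓ D w.length k = I w :=
  (hI.bijOn w.length).mapsTo rfl

theorem measurableSet (hI : IsCubeCoding ℓ D I) (w : List (Fin (ℓ ^ D))) :
    MeasurableSet (I w) := by
  obtain ⟨k, hk⟩ := hI.exists_ladicCube_eq w
  exact hk ▸ measurableSet_ladicCube k

theorem dist_le (hI : IsCubeCoding ℓ D I) {w : List (Fin (ℓ ^ D))}
    {x y : EuclideanSpace ℝ (Fin D)} (hx : x ∈ I w) (hy : y ∈ I w) :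
    dist x y ≤ √D * ((ℓ : ℝ) ^ w.length)⁻¹ := by
  obtain ⟨k, hk⟩ := hI.exists_ladicCube_eq w
  rw [← hk] at hx hy
  exact dist_le_of_mem_ladicCube hx hy

theorem append_subset (hI : IsCubeCoding ℓ D I) (u v : List (Fin (ℓ ^ D))) :
    I (u ++ v) ⊆ I u := by
  induction v using List.reverseRecOn with
  | nil => rw [List.append_nil]
  | append_singleton v a ih =>
    rw [← List.append_assoc]
    exact (hI.nested _ _).trans ih

theorem pairwiseDisjoint (hI : IsCubeCoding ℓ D I) (hℓ : 0 < ℓ) (n : ℕ) :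
    {w | w.length = n}.PairwiseDisjoint I := by
  intro w hw w' hw' hne
  refine Set.disjoint_left.2 fun x hx hx' => hne ((hI.bijOn n).injOn hw hw' ?_)
  obtain ⟨k, hk⟩ := (hI.bijOn n).mapsTo hw
  obtain ⟨k', hk'⟩ := (hI.bijOn n).mapsTo hw'
  rw [← hk] at hx
  rw [← hk'] at hx'
  rw [← hk, ← hk', eq_of_mem_ladicCube hℓ hx hx']

theorem exists_length_eq_and_mem (hI : IsCubeCoding ℓ D I) (hℓ : 0 < ℓ) (n : ℕ)
    {x : EuclideanSpace ℝ (Fin D)} (hx : x ∈ unitCube D) : ∃ w, w.length = n ∧ x ∈ I w := by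
  obtain ⟨k, hk⟩ := exists_mem_ladicCube hℓ n hx
  obtain ⟨w, hw, hwk⟩ := (hI.bijOn n).surjOn ⟨k, rfl⟩
  exact ⟨w, hw, hwk ▸ hk⟩

theorem sum_ladicCube (hI : IsCubeCoding ℓ D I) (hℓ : 0 < ℓ) (n : ℕ)
    (f : Set (EuclideanSpace ℝ (Fin D)) → ℝ) :
    ∑ k, f (ladicCube ℓ D n k) = ∑ w ∈ words (Fin (ℓ ^ D)) n, f (I w) :=
  calc ∑ k, f (ladicCube ℓ D n k) = ∑ᶠ k, f (ladicCube ℓ D n k) := (finsum_eq_sum_of_fintype _).symm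
    _ = ∑ᶠ Q ∈ ladicCubes ℓ D n, f Q := (finsum_mem_range (ladicCube_injective hℓ)).symm
    _ = ∑ᶠ w ∈ {w : List (Fin (ℓ ^ D)) | w.length = n}, f (I w) :=
        (finsum_mem_eq_of_bijOn I (hI.bijOn n) fun _ _ => rfl).symm
    _ = ∑ w ∈ words (Fin (ℓ ^ D)) n, f (I w) := by
        rw [← finsum_mem_coe_finset]
        simp only [Finset.mem_coe, mem_words, Set.mem_ofPred_eq]

variable {m : Measure (EuclideanSpace ℝ (Fin D))}

theorem lqSpectrumAt_eq (hI : IsCubeCoding ℓ D I) (hℓ : 0 < ℓ) (n : ℕ) (q : ℝ) :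
    lqSpectrumAt ℓ m n q =
      Real.log (partitionSum (fun w => m.real (I w)) n q) / n / Real.log ℓ := by
  classical
  rw [lqSpectrumAt, hI.sum_ladicCube hℓ n fun Q => if 0 < m.real Q then m.real Q ^ q else 0,
    partitionSum, posWords, Finset.sum_filter, div_div, one_div_mul_eq_div]

variable [IsProbabilityMeasure m]

theorem ae_exists_length_eq_and_mem (hI : IsCubeCoding ℓ D I) (hℓ : 0 < ℓ)
    (hm : IsQuasiBernoulli I m) (n : ℕ) : ∀ᵐ x ∂m, ∃ w, w.length = n ∧ x ∈ I w :=
  have hunit : ∀ᵐ x ∂m, x ∈ unitCube D :=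
    (mem_ae_iff_prob_eq_one measurableSet_unitCube).2 hm.unitCube_eq_one
  hunit.mono fun _ => hI.exists_length_eq_and_mem hℓ n

theorem measureReal_biUnion_eq_sum (hI : IsCubeCoding ℓ D I) (hℓ : 0 < ℓ) {n : ℕ}
    {F : Finset (List (Fin (ℓ ^ D)))} (hF : ∀ w ∈ F, w.length = n) :
    m.real (⋃ w ∈ F, I w) = ∑ w ∈ F, m.real (I w) :=
  measureReal_biUnion_finset ((hI.pairwiseDisjoint hℓ n).subset hF) fun w _ => hI.measurableSet w

theorem exists_isQuasiMultiplicative (hI : IsCubeCoding ℓ D I) (hℓ : 0 < ℓ)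
    (hm : IsQuasiBernoulli I m) : ∃ C, IsQuasiMultiplicative (fun w => m.real (I w)) C := by
  obtain ⟨C, hC, hquasi⟩ := hm.quasiBernoulli
  refine ⟨C, hC, fun _ => measureReal_nonneg, fun n => ?_, fun u v => (hquasi u v).1,
    fun u v => (hquasi u v).2⟩
  have hcover : ∀ᵐ x ∂m, x ∈ ⋃ w ∈ words (Fin (ℓ ^ D)) n, I w :=
    (hI.ae_exists_length_eq_and_mem hℓ hm n).mono fun x ⟨w, hw, hx⟩ =>
      Set.mem_biUnion (mem_words.2 hw) hx
  rw [← hI.measureReal_biUnion_eq_sum hℓ fun _ => mem_words.1, ← probReal_univ (μ := m)]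
  exact measureReal_congr (eventuallyEq_univ.2 hcover)

theorem tendsto_log_partitionSum_div (hI : IsCubeCoding ℓ D I) (hℓ : 2 ≤ ℓ)
    (hm : IsQuasiBernoulli I m) (q : ℝ) :
    Tendsto (fun n : ℕ => Real.log (partitionSum (fun w => m.real (I w)) n q) / n) atTop
      (𝓝 (Real.log ℓ * lqSpectrum ℓ m q)) := by
  have hlog : Real.log ℓ ≠ 0 := (Real.log_pos (Nat.one_lt_cast.2 hℓ)).ne'
  obtain ⟨C, hp⟩ := hI.exists_isQuasiMultiplicative (by lia) hm
  obtain ⟨T, hT, -⟩ := exists_tendsto_div_of_quasiAdditive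
    (u := fun n => Real.log (partitionSum (fun w => m.real (I w)) n q))
    (hp.abs_log_partitionSum_add_le q)
  have hτ : lqSpectrum ℓ m q = T / Real.log ℓ := by
    simp only [lqSpectrum, hI.lqSpectrumAt_eq (by lia : 0 < ℓ)]
    exact (hT.div_const _).limsup_eq
  rwa [hτ, mul_div_cancel₀ _ hlog]

theorem ae_mem_of_forall_mul_le (hI : IsCubeCoding ℓ D I) (hℓ : 2 ≤ ℓ) (hm : IsQuasiBernoulli I m)
    {B : Set (EuclideanSpace ℝ (Fin D))} (hB : MeasurableSet B) {c : ℝ≥0∞} (hc : c ≠ 0)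
    (hle : ∀ w, c * m (I w) ≤ m (B ∩ I w)) : ∀ᵐ x ∂m, x ∈ B := by
  have hℓ0 : 0 < ℓ := by lia
  have hmesh : Tendsto (fun n : ℕ => √D * ((ℓ : ℝ) ^ n)⁻¹) atTop (𝓝 0) := by
    simpa only [mul_zero] using
      ((tendsto_inv_pow_nhdsGT_zero hℓ).mono_right nhdsWithin_le_nhds).const_mul √D
  refine ae_mem_of_forall_mul_cell_le hI.measurableSet (hI.pairwiseDisjoint hℓ0)
    (hI.ae_exists_length_eq_and_mem hℓ0 hm) ?_ hmesh hB hc hle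
  rintro _ w rfl x hx y hy
  exact hI.dist_le hx hy

theorem ae_frequently_mem_of_quasiSuperadditive (hI : IsCubeCoding ℓ D I) (hℓ : 2 ≤ ℓ)
    (hm : IsQuasiBernoulli I m) {Y : List (Fin (ℓ ^ D)) → ℝ} {b c : ℝ}
    (hY : ∀ u v, 0 < m.real (I u) → 0 < m.real (I v) → Y u + Y v - b ≤ Y (u ++ v)) (hc : 0 < c)
    (hev : ∀ᶠ n : ℕ in atTop,
      c ≤ ∑ w ∈ posWords (fun w => m.real (I w)) n with √n < Y w, m.real (I w)) :
    ∀ᵐ x ∂m, ∃ᶠ n : ℕ in atTop, ∃ w, w.length = n ∧ x ∈ I w ∧ 0 < m.real (I w) ∧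
      √n / 2 < Y w := by
  have hℓ0 : 0 < ℓ := by lia
  obtain ⟨C, hp⟩ := hI.exists_isQuasiMultiplicative hℓ0 hm
  have hC : 0 < C := zero_lt_one.trans_le hp.one_le
  let s : ℕ → Set (EuclideanSpace ℝ (Fin D)) := fun n =>
    ⋃ w ∈ {w ∈ posWords (fun w => m.real (I w)) n | √n / 2 < Y w}, I w
  have hs : ∀ n, MeasurableSet (s n) := fun n =>
    Finset.measurableSet_biUnion _ fun w _ => hI.measurableSet w
  have hdensity : ∀ u, ENNReal.ofReal (c / C) * m (I u) ≤ m (limsup s atTop ∩ I u) := by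
    intro u
    rw [← Measure.restrict_apply (.measurableSet_limsup hs)]
    refine le_measure_limsup_of_frequently_le hs
      ((hp.eventually_le_sum_of_prefix hY hev u).mono fun n hn => ?_).frequently
    rw [← hI.measureReal_biUnion_eq_sum hℓ0 fun w hw =>
      (mem_posWords.1 (Finset.mem_filter.1 hw).1).1] at hn
    rw [Measure.restrict_apply (hs n), ← ofReal_measureReal (s := I u),
      ← ENNReal.ofReal_mul (by positivity), ← ofReal_measureReal (s := s n ∩ I u)]
    refine ENNReal.ofReal_le_ofReal (hn.trans (measureReal_mono (Set.iUnion₂_subset ?_)))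
    intro w hw
    obtain ⟨hpos, ⟨v, rfl⟩, hYw⟩ := Finset.mem_filter.1 hw
    exact Set.subset_inter (Set.subset_biUnion_of_mem (u := I)
      (Finset.mem_coe.2 (Finset.mem_filter.2 ⟨hpos, hYw⟩))) (hI.append_subset u v)
  have hlimsup := hI.ae_mem_of_forall_mul_le hℓ hm (.measurableSet_limsup hs)
    (ENNReal.ofReal_pos.2 (div_pos hc hC)).ne' hdensity
  filter_upwards [hlimsup] with x hx
  refine (mem_limsup_iff_frequently_mem.1 hx).mono fun n hn => ?_
  obtain ⟨w, hw, hxw⟩ := Set.mem_iUnion₂.1 hn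
  obtain ⟨hpos, hYw⟩ := Finset.mem_filter.1 hw
  obtain ⟨hlen, hpos⟩ := mem_posWords.1 hpos
  exact ⟨w, hlen, hxw, hpos, hYw⟩

theorem ae_frequently_lt_deviation (hI : IsCubeCoding ℓ D I) (hℓ : 2 ≤ ℓ)
    (hm : IsQuasiBernoulli I m) {d σ : ℝ} (hσ : 0 < σ)
    (hτ : (fun q : ℝ => lqSpectrum ℓ m (1 - q) - (q * d + σ ^ 2 / 2 * q ^ 2))
      =o[𝓝 0] fun q : ℝ => q ^ 2) :
    (∀ᵐ x ∂m, ∃ᶠ n : ℕ in atTop, ∃ w, w.length = n ∧ x ∈ I w ∧ 0 < m.real (I w) ∧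
      √n / 2 < deviation (fun w => m.real (I w)) (d * Real.log ℓ) w) ∧
    ∀ᵐ x ∂m, ∃ᶠ n : ℕ in atTop, ∃ w, w.length = n ∧ x ∈ I w ∧ 0 < m.real (I w) ∧
      √n / 2 < -deviation (fun w => m.real (I w)) (d * Real.log ℓ) w := by
  have hlog : 0 < Real.log ℓ := Real.log_pos (Nat.one_lt_cast.2 hℓ)
  obtain ⟨C, hp⟩ := hI.exists_isQuasiMultiplicative (by lia) hm
  obtain ⟨⟨c, hc, hev⟩, c', hc', hev'⟩ := hp.exists_pos_eventually_le_sum_deviation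
    (h := d * Real.log ℓ) (v := σ ^ 2 * Real.log ℓ) (by positivity)
    (hI.tendsto_log_partitionSum_div hℓ hm)
    ((hτ.const_mul_left (Real.log ℓ)).congr_left fun q => by ring)
  have hquasi := fun u v hu hv =>
    abs_le.1 (hp.abs_deviation_append_sub_le (d * Real.log ℓ) (u := u) (v := v) hu hv)
  constructor
  · refine hI.ae_frequently_mem_of_quasiSuperadditive hℓ hm (b := Real.log C)
      (fun u v hu hv => ?_) hc hev
    linarith [(hquasi u v hu hv).1]
  · refine hI.ae_frequently_mem_of_quasiSuperadditive hℓ hm (b := Real.log C)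
      (fun u v hu hv => ?_) hc' hev'
    linarith [(hquasi u v hu hv).2]

theorem ae_hasZeroLowerDensity (hI : IsCubeCoding ℓ D I) (hℓ : 2 ≤ ℓ) (hm : IsQuasiBernoulli I m)
    {d σ : ℝ} (hσ : 0 < σ)
    (hτ : (fun q : ℝ => lqSpectrum ℓ m (1 - q) - (q * d + σ ^ 2 / 2 * q ^ 2))
      =o[𝓝 0] fun q : ℝ => q ^ 2) :
    ∀ᵐ x ∂m, HasZeroLowerDensity m d x := by
  have hℓ0 : 0 < ℓ := by lia
  -- Half of the gain `exp (-√n / 2)` pays for replacing the cube by a ball; the rest tends to `0`.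
  have hsummable : Summable fun n : ℕ => Real.exp (-(1 / 4) * √n) :=
    summable_exp_neg_mul_sqrt (by norm_num)
  filter_upwards [(hI.ae_frequently_lt_deviation hℓ hm hσ hτ).1,
    ae_eventually_mul_closedBall_le_ladicCube hℓ0 m hsummable.tsum_ofReal_ne_top]
    with x hdev hball η hη
  refine (tendsto_inv_pow_nhdsGT_zero hℓ).frequently ((hdev.and_eventually
    (hball.and (hsummable.tendsto_atTop_zero.eventually_le_const hη))).mono ?_)
  rintro _ ⟨⟨w, rfl, hxw, hpos, hdev⟩, hball, hsmall⟩
  set r := ((ℓ : ℝ) ^ w.length)⁻¹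
  set e := Real.exp (-(1 / 4) * √w.length)
  have hcube : e * m.real (Metric.closedBall x r) ≤ m.real (I w) := by
    obtain ⟨k, hk⟩ := hI.exists_ladicCube_eq w
    have hle := hball k (hk ▸ hxw)
    rwa [hk, ← ofReal_measureReal, ← ofReal_measureReal, ← ENNReal.ofReal_mul (by positivity),
      ENNReal.ofReal_le_ofReal_iff measureReal_nonneg] at hle
  have hlight : m.real (I w) ≤ e * (e * r ^ d) := by
    rw [← exp_neg_deviation_mul_inv_pow_rpow (p := fun w => m.real (I w)) hpos hℓ0 d, ← mul_assoc,
      ← Real.exp_add]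
    gcongr
    linarith
  rw [← ofReal_measureReal]
  refine ENNReal.ofReal_le_ofReal ?_
  calc m.real (Metric.closedBall x r) ≤ e * r ^ d :=
        le_of_mul_le_mul_left (hcube.trans hlight) (Real.exp_pos _)
    _ ≤ η * r ^ d := by gcongr

theorem ae_hasInfiniteUpperDensity (hI : IsCubeCoding ℓ D I) (hℓ : 2 ≤ ℓ)
    (hm : IsQuasiBernoulli I m) {d σ : ℝ} (hσ : 0 < σ)
    (hτ : (fun q : ℝ => lqSpectrum ℓ m (1 - q) - (q * d + σ ^ 2 / 2 * q ^ 2))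
      =o[𝓝 0] fun q : ℝ => q ^ 2) :
    ∀ᵐ x ∂m, HasInfiniteUpperDensity m d x := by
  filter_upwards [(hI.ae_frequently_lt_deviation hℓ hm hσ hτ).2] with x hdev K
  have hradius : Tendsto (fun n : ℕ => (√D + 1) * ((ℓ : ℝ) ^ n)⁻¹) atTop (𝓝[>] 0) := by
    refine tendsto_nhdsWithin_iff.2 ⟨?_, .of_forall fun n => Set.mem_Ioi.2 (by positivity)⟩
    simpa only [mul_zero] using
      ((tendsto_inv_pow_nhdsGT_zero hℓ).mono_right nhdsWithin_le_nhds).const_mul (√D + 1)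
  have hlarge : ∀ᶠ n : ℕ in atTop, K * (√D + 1) ^ d ≤ Real.exp (√n / 2) :=
    (Real.tendsto_exp_atTop.comp
      (tendsto_sqrt_natCast_atTop.atTop_div_const two_pos)).eventually_ge_atTop _
  refine hradius.frequently ((hdev.and_eventually hlarge).mono ?_)
  rintro _ ⟨⟨w, rfl, hxw, hpos, hdev⟩, hK⟩
  set r := ((ℓ : ℝ) ^ w.length)⁻¹
  have hr : 0 < r := by positivity
  have hsub : I w ⊆ Metric.closedBall x ((√D + 1) * r) := fun y hy =>
    (hI.dist_le hy hxw).trans (by gcongr; linarith)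
  refine le_trans ?_ (measure_mono hsub)
  rw [← ofReal_measureReal]
  refine ENNReal.ofReal_le_ofReal ?_
  calc K * ((√D + 1) * r) ^ d = K * (√D + 1) ^ d * r ^ d := by
        rw [Real.mul_rpow (by positivity) hr.le, mul_assoc]
    _ ≤ Real.exp (-deviation (fun w => m.real (I w)) (d * Real.log ℓ) w) * r ^ d := by
        gcongr
        exact hK.trans (Real.exp_le_exp.2 hdev.le)
    _ = m.real (I w) := exp_neg_deviation_mul_inv_pow_rpow hpos (by lia) d

end IsCubeCoding

end QB

theorem mainTheorem9 (ℓ D : ℕ) (hℓ : 2 ≤ ℓ)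
    (I : List (Fin (ℓ ^ D)) → Set (EuclideanSpace ℝ (Fin D))) (hI : QB.IsCubeCoding ℓ D I)
    (m : Measure (EuclideanSpace ℝ (Fin D))) [IsProbabilityMeasure m]
    (hm : QB.IsQuasiBernoulli I m)
    (d σ : ℝ) (hd : d = -deriv (QB.lqSpectrum ℓ m) 1) (hσ : 0 < σ)
    (hτ : (fun q : ℝ => QB.lqSpectrum ℓ m (1 - q) - (q * d + σ ^ 2 / 2 * q ^ 2))
      =o[𝓝 0] fun q : ℝ => q ^ 2) :
    (∃ E : Set (EuclideanSpace ℝ (Fin D)),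
        MeasurableSet E ∧ m E = 1 ∧ Measure.hausdorffMeasure d E = 0) ∧
      m ⟂ₘ Measure.hausdorffMeasure d ∧
      (∀ E : Set (EuclideanSpace ℝ (Fin D)),
        QB.packingMeasure (EuclideanSpace ℝ (Fin D)) d E < ∞ → m E = 0) ∧
      (∀ E : Set (EuclideanSpace ℝ (Fin D)),
        QB.packingMeasure (EuclideanSpace ℝ (Fin D)) d E = 0 → m E = 0) := by
  have hH := QB.exists_measurableSet_hausdorffMeasure_eq_zero
    (hI.ae_hasInfiniteUpperDensity hℓ hm hσ hτ)
  have hP : ∀ E, QB.packingMeasure _ d E < ∞ → m E = 0 := fun E hE =>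
    QB.measure_eq_zero_of_packingMeasure_lt_top (hI.ae_hasZeroLowerDensity hℓ hm hσ hτ) hE
  refine ⟨hH, ?_, hP, fun E hE => hP E (hE ▸ ENNReal.zero_lt_top)⟩
  obtain ⟨E, hE, hmE, hHE⟩ := hH
  exact ⟨Eᶜ, hE.compl, (prob_compl_eq_zero_iff hE).2 hmE, by rwa [compl_compl]⟩
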